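/- Let $n\ge 1$, let $a_1,\dots,a_n,b\in\mathbb Z$ with $\gcd(a_1,\dots,a_n)=1$, and let $\mathcal H=\{x\in\mathbb R^n : a_1x_1+\cdots+a_nx_n=b\}$. Call a nonzero point $x\in\mathbb Z^n$ visible if the line segment from the origin to $x$ contains no lattice points other than its two end points (equivalently, $\gcd(x_1,\dots,x_n)=1$); the origin is not visible. For real $r>0$ let $\mathcal H_1(r)$ be the set of lattice points in $\mathcal H\cap[-r,r]^n$ and $\mathcal H_0(r)$ the set of visible points in $\mathcal H_1(r)$. Then $\mathcal H_1(r)\neq\emptyset$ for all large $r$, and the density $$\rho(\mathcal H)=\lim_{r\to\infty}\frac{|\mathcal H_0(r)|}{|\mathcal H_1(r)|}$$ exists and satisfies $$\rho(\mathcal H)=\prod_{p\mid b}\left(1-\frac1{p^{\,n-1}}\right),$$ where the product is over all primes $p$ dividing $b$; for $b=0$ it is over all primes and is understood as the (order-independent) limit of its finite partial products, the value $0$ being allowed. If $b\ne 0$, then moreover $$\rho(\mathcal H)=\frac{J_{n-1}(|b|)}{|b|^{\,n-1}},$$ where, for integers $k\ge 0$ and $m\ge 1$, the Jordan totient $J_k(m)$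 is the number of $k$-tuples $(v_1,\dots,v_k)\in\{0,\dots,m-1\}^k$ with $\gcd(v_1,\dots,v_k,m)=1$. If $b=0$, then $\rho(\mathcal H)=1/\zeta(n-1)$ when $n\ge 3$, where $\zeta$ is the Riemann zeta function, and $\rho(\mathcal H)=0$ when $n=2$. -/

import Mathlib

open Filter Topology

namespace VisibleLattice

/-- The lattice `ℤⁿ` as a subset of `ℝⁿ`. -/
def lattice (n : ℕ) : Set (Fin n → ℝ) :=
  Set.range fun (z : Fin n → ℤ) (i : Fin n) => (z i : ℝ)

/-- A lattice point is visible if it is not the origin and the line segment joining it to the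
origin contains no lattice points besides its two end points. -/
def IsVisible {n : ℕ} (x : Fin n → ℝ) : Prop :=
  x ∈ lattice n ∧ x ≠ 0 ∧ ∀ y ∈ segment ℝ 0 x, y ∈ lattice n → y = 0 ∨ y = x

/-- A lattice point is visible iff the gcd of its coordinates is `1`. -/
theorem isVisible_iff_gcd_eq_one {n : ℕ} (z : Fin n → ℤ) :
    IsVisible (fun i => (z i : ℝ)) ↔ Finset.univ.gcd z = 1 := by
  constructor
  · rintro ⟨-, h0, h⟩
    have hz : ∃ i, z i ≠ 0 := by
      by_contra! hc
      exact h0 (funext fun i => by simp [hc i])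
    obtain ⟨i, hi⟩ := hz
    obtain ⟨w, hw, -⟩ := Finset.extract_gcd z ⟨i, Finset.mem_univ i⟩
    have hg0 : Finset.univ.gcd z ≠ 0 := fun h' => hi (by rw [hw i (Finset.mem_univ i), h', zero_mul])
    have hgn : 0 ≤ Finset.univ.gcd z := by
      rw [← Finset.normalize_gcd]; exact Int.nonneg_of_normalize_eq_self (by simp)
    set g := Finset.univ.gcd z with hg
    have hg1 : 1 ≤ g := by omega
    have hg1' : (1 : ℝ) ≤ g := by exact_mod_cast hg1
    have hwi : w i ≠ 0 := fun h' => hi (by rw [hw i (Finset.mem_univ i), h', mul_zero])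
    have hzr : ∀ j, (z j : ℝ) = g * w j := fun j => by
      exact_mod_cast hw j (Finset.mem_univ j)
    have hseg : (fun j => (w j : ℝ)) ∈ segment ℝ 0 (fun j => (z j : ℝ)) := by
      rw [segment_eq_image]
      refine ⟨1 / g, ⟨by positivity, (div_le_one (by linarith)).2 hg1'⟩, ?_⟩
      funext j
      have : (g : ℝ) ≠ 0 := by linarith
      simp only [smul_zero, zero_add, Pi.smul_apply, smul_eq_mul, hzr]
      field_simp
    rcases h _ hseg ⟨w, rfl⟩ with h1 | h1
    · exact absurd (congrFun h1 i) (by simpa using hwi)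
    · have := congrFun h1 i
      have h2 : w i = z i := by exact_mod_cast this
      rw [hw i (Finset.mem_univ i)] at h2
      exact (mul_right_cancel₀ hwi (by rw [one_mul]; exact h2)).symm
  · intro h
    refine ⟨⟨z, rfl⟩, ?_, ?_⟩
    · intro h0
      have : Finset.univ.gcd z = 0 := Finset.gcd_eq_zero_iff.2 fun i _ => by
        have := congrFun h0 i
        simpa using this
      omega
    · rintro y hy ⟨w, rfl⟩
      rw [segment_eq_image] at hy
      obtain ⟨t, ⟨ht0, ht1⟩, hy⟩ := hy
      have hy' : ∀ i, t * z i = w i := fun i => by simpa using congrFun hy i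
      obtain ⟨c, hc⟩ : ∃ c : Fin n → ℤ, ∑ i, c i * z i = 1 := by
        have h1 : Ideal.span (Set.range z) = ⊤ := by
          obtain ⟨d, hd⟩ := (IsPrincipalIdealRing.principal (Ideal.span (Set.range z))).principal
          rw [← Ideal.span] at hd
          rw [hd, Ideal.span_singleton_eq_top]
          refine isUnit_of_dvd_one ?_
          rw [← h]
          refine Finset.dvd_gcd fun i _ => ?_
          rw [← Ideal.mem_span_singleton, ← hd]
          exact Ideal.subset_span ⟨i, rfl⟩
        have h2 : (1 : ℤ) ∈ Ideal.span (Set.range z) := by rw [h1]; trivial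
        obtain ⟨c, hc⟩ := (Ideal.mem_span_range_iff_exists_fun).1 h2
        exact ⟨c, hc⟩
      have ht : t = ((∑ i, c i * w i : ℤ) : ℝ) := by
        have : (∑ i, (c i : ℝ) * z i) = 1 := by exact_mod_cast hc
        calc t = t * ∑ i, (c i : ℝ) * z i := by rw [this, mul_one]
          _ = _ := by
            push_cast
            rw [Finset.mul_sum]
            exact Finset.sum_congr rfl fun i _ => by rw [← hy' i]; ring
      generalize (∑ i, c i * w i : ℤ) = k at ht
      subst ht
      have hk0 : 0 ≤ k := by exact_mod_cast ht0
      have hk1 : k ≤ 1 := by exact_mod_cast ht1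
      obtain rfl | rfl : k = 0 ∨ k = 1 := by omega
      · left; funext i; simpa using (hy' i).symm
      · right; funext i; simpa using (hy' i).symm

/-- The lattice points of `Δ` in the box `[-r, r]ⁿ`. -/
def latticePts {n : ℕ} (Δ : Set (Fin n → ℝ)) (r : ℝ) : Set (Fin n → ℝ) :=
  {x | x ∈ Δ ∧ (∀ i, x i ∈ Set.Icc (-r) r) ∧ x ∈ lattice n}

/-- The visible lattice points of `Δ` in the box `[-r, r]ⁿ`. -/
def visiblePts {n : ℕ} (Δ : Set (Fin n → ℝ)) (r : ℝ) : Set (Fin n → ℝ) :=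
  {x | x ∈ latticePts Δ r ∧ IsVisible x}

/-- The density of visible points in `Δ` exists and equals `ρ`: the ratio of the numbers of visible
lattice points and of lattice points of `Δ` in `[-r, r]ⁿ` is defined for all large real `r`, and
tends to `ρ` as `r → ∞`. -/
def HasVisibleDensity {n : ℕ} (Δ : Set (Fin n → ℝ)) (ρ : ℝ) : Prop :=
  (∀ᶠ r : ℝ in atTop, (latticePts Δ r).Nonempty) ∧
    Tendsto (fun r : ℝ => ((visiblePts Δ r).ncard : ℝ) / ((latticePts Δ r).ncard : ℝ))
      atTop (𝓝 ρ)

/-- The hyperplane `a₁ x₁ + ⋯ + aₙ xₙ = b` in `ℝⁿ`. -/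
def hyperplane {n : ℕ} (a : Fin n → ℤ) (b : ℤ) : Set (Fin n → ℝ) :=
  {x | ∑ i, (a i : ℝ) * x i = (b : ℝ)}

/-- The Jordan totient `J_k(m)` for `m ≥ 1`: the number of `k`-tuples of residues
`0, …, m - 1` whose gcd is coprime to `m`. -/
def jordanTotient (k m : ℕ) : ℕ :=
  ((Fintype.piFinset fun _ : Fin k => Finset.range m).filter
    fun v => Nat.Coprime (Finset.univ.gcd v) m).card

end VisibleLattice

namespace VisibleLattice

open scoped Pointwise

/-! The integer points of the hyperplane in `[-r, r]ⁿ` number `~ C r^(n-1)`, with `C > 0`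
independent of `b`. For `b = 0` they form a lattice of rank `n - 1` and `C` is a volume
(`tendsto_card_boxPts_zero`); integer translations carry this to every `b` (`tendsto_card_boxPts`).

If a prime `q` divides `b`, division by `q` matches the points divisible by `q` with the points of
level `b / q` in the box of radius `r / q`, a proportion `q^(-(n-1))` because `C` does not depend on
the level. Removing finitely many primes one at a time gives the finite product
(`tendsto_card_sievedPts`). A common divisor of the coordinates divides `b`, so for `b ≠ 0` this is
already the answer, and the same sieve on residues evaluates the Jordan totient.

For `b = 0` finite sieves give the upper bound. When `n ≥ 3`, the points divisible by some `p ≥ Q`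
are controlled by a tail of `∑ p^(-(n-1))`, which gives the lower bound
(`eventually_lt_card_filter_gcd`). When `n < 3` the product is `0` and no lower bound is needed. -/

/-- The integer points of the hyperplane `a · z = b` in the box `[-r, r]ⁿ`. -/
noncomputable def boxPts {n : ℕ} (a : Fin n → ℤ) (b : ℤ) (r : ℝ) : Finset (Fin n → ℤ) :=
  (Fintype.piFinset fun _ => Finset.Icc ⌈-r⌉ ⌊r⌋).filter fun z => ∑ i, a i * z i = b

/-! ### Passing from real points to integer vectors -/

theorem mem_boxPts {n : ℕ} {a : Fin n → ℤ} {b : ℤ} {r : ℝ} {z : Fin n → ℤ} :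
    z ∈ boxPts a b r ↔ (∀ i, |(z i : ℝ)| ≤ r) ∧ ∑ i, a i * z i = b := by
  simp [boxPts, Int.ceil_le, Int.le_floor, abs_le]

theorem boxPts_mono {n : ℕ} (a : Fin n → ℤ) (b : ℤ) : Monotone (boxPts a b) := by
  intro r s h z hz
  rw [mem_boxPts] at hz ⊢
  exact ⟨fun i => (hz.1 i).trans h, hz.2⟩

theorem intCast_injective (n : ℕ) :
    Function.Injective fun (z : Fin n → ℤ) (i : Fin n) => (z i : ℝ) := by
  intro z w h
  funext i
  have := congrFun h i
  simpa using this

theorem latticePts_hyperplane {n : ℕ} (a : Fin n → ℤ) (b : ℤ) (r : ℝ) :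
    latticePts (hyperplane a b) r =
      (fun (z : Fin n → ℤ) (i : Fin n) => (z i : ℝ)) '' (boxPts a b r : Set (Fin n → ℤ)) := by
  ext x
  simp only [latticePts, hyperplane, Set.mem_ofPred_eq, Set.mem_image, Finset.mem_coe, mem_boxPts,
    lattice, Set.mem_range]
  constructor
  · rintro ⟨h1, h2, z, rfl⟩
    exact ⟨z, ⟨fun i => abs_le.2 (h2 i), by beta_reduce at h1; exact_mod_cast h1⟩, rfl⟩
  · rintro ⟨z, ⟨h1, h2⟩, rfl⟩
    exact ⟨by beta_reduce; exact_mod_cast h2, fun i => abs_le.1 (h1 i), z, rfl⟩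

theorem visiblePts_hyperplane {n : ℕ} (a : Fin n → ℤ) (b : ℤ) (r : ℝ) :
    visiblePts (hyperplane a b) r = (fun (z : Fin n → ℤ) (i : Fin n) => (z i : ℝ)) ''
      ((boxPts a b r).filter fun z => Finset.univ.gcd z = 1 : Finset (Fin n → ℤ)) := by
  ext x
  simp only [visiblePts, latticePts_hyperplane, Set.mem_ofPred_eq, Set.mem_image, Finset.mem_coe,
    Finset.mem_filter]
  constructor
  · rintro ⟨⟨z, hz, rfl⟩, h⟩
    exact ⟨z, ⟨hz, (isVisible_iff_gcd_eq_one z).1 h⟩, rfl⟩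
  · rintro ⟨z, ⟨hz, h⟩, rfl⟩
    exact ⟨⟨z, hz, rfl⟩, (isVisible_iff_gcd_eq_one z).2 h⟩

theorem ncard_latticePts_hyperplane {n : ℕ} (a : Fin n → ℤ) (b : ℤ) (r : ℝ) :
    (latticePts (hyperplane a b) r).ncard = (boxPts a b r).card := by
  rw [latticePts_hyperplane, Set.ncard_image_of_injective _ (intCast_injective n),
    Set.ncard_coe_finset]

theorem ncard_visiblePts_hyperplane {n : ℕ} (a : Fin n → ℤ) (b : ℤ) (r : ℝ) :
    (visiblePts (hyperplane a b) r).ncard =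
      ((boxPts a b r).filter fun z => Finset.univ.gcd z = 1).card := by
  rw [visiblePts_hyperplane, Set.ncard_image_of_injective _ (intCast_injective n),
    Set.ncard_coe_finset]

/-! ### Asymptotic count of lattice points on the hyperplane -/

theorem exists_sum_mul_eq_one {n : ℕ} {z : Fin n → ℤ} (h : Finset.univ.gcd z = 1) :
    ∃ c : Fin n → ℤ, ∑ i, z i * c i = 1 := by
  have h1 : Ideal.span (Set.range z) = ⊤ := by
    obtain ⟨d, hd⟩ := (IsPrincipalIdealRing.principal (Ideal.span (Set.range z))).principal
    rw [← Ideal.span] at hd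
    rw [hd, Ideal.span_singleton_eq_top]
    refine isUnit_of_dvd_one ?_
    rw [← h]
    refine Finset.dvd_gcd fun i _ => ?_
    rw [← Ideal.mem_span_singleton, ← hd]
    exact Ideal.subset_span ⟨i, rfl⟩
  have h2 : (1 : ℤ) ∈ Ideal.span (Set.range z) := by rw [h1]; trivial
  obtain ⟨c, hc⟩ := (Ideal.mem_span_range_iff_exists_fun).1 h2
  exact ⟨c, by rw [← hc]; exact Finset.sum_congr rfl fun i _ => mul_comm _ _⟩

/-- Integer matrices parametrizing the lattice `a · z = 0` by `ℤⁿ⁻¹`. -/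
theorem exists_param_kernel {n : ℕ} {a : Fin n → ℤ} (ha : Finset.univ.gcd a = 1) :
    ∃ (M : Matrix (Fin n) (Fin (n - 1)) ℤ) (P : Matrix (Fin (n - 1)) (Fin n) ℤ),
      P * M = 1 ∧ (∀ y, ∑ i, a i * M.mulVec y i = 0) ∧
        ∀ z : Fin n → ℤ, ∑ i, a i * z i = 0 → M.mulVec (P.mulVec z) = z := by
  obtain ⟨c, hc⟩ := exists_sum_mul_eq_one ha
  let f : (Fin n → ℤ) →ₗ[ℤ] ℤ :=
    { toFun := fun z => ∑ i, a i * z i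
      map_add' := fun x y => by simp [mul_add, Finset.sum_add_distrib]
      map_smul' := fun t x => by simp [Finset.mul_sum, mul_left_comm] }
  have hfc : f c = 1 := hc
  have hf : Function.Surjective f := fun t => ⟨t • c, by rw [map_smul, hfc]; simp⟩
  have hrank : Module.finrank ℤ f.ker = n - 1 := by
    have h := f.ker.finrank_quotient_add_finrank
    rw [(f.quotKerEquivOfSurjective hf).finrank_eq] at h
    simp at h
    omega
  let e : f.ker ≃ₗ[ℤ] (Fin (n - 1) → ℤ) :=
    (Module.finBasisOfFinrankEq ℤ f.ker hrank).equivFun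
  -- The projection `z ↦ z - f z • c` along `c`; it lands in the kernel because `f c = 1`.
  let π : (Fin n → ℤ) →ₗ[ℤ] f.ker :=
    LinearMap.codRestrict f.ker (LinearMap.id - f.smulRight c) fun z => by
      rw [LinearMap.mem_ker, LinearMap.sub_apply, LinearMap.smulRight_apply, map_sub, map_smul,
        hfc]
      simp
  have hπ : ∀ z : f.ker, π z = z := fun z => by
    apply Subtype.ext
    have : f z = 0 := z.2
    simp [π, this]
  let m : (Fin (n - 1) → ℤ) →ₗ[ℤ] (Fin n → ℤ) := f.ker.subtype ∘ₗ e.symm.toLinearMap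
  let p : (Fin n → ℤ) →ₗ[ℤ] (Fin (n - 1) → ℤ) := e.toLinearMap ∘ₗ π
  refine ⟨LinearMap.toMatrix' m, LinearMap.toMatrix' p, ?_, ?_, ?_⟩
  · rw [← LinearMap.toMatrix'_comp, ← LinearMap.toMatrix'_id]
    congr 1
    apply LinearMap.ext
    intro y
    simp [p, m, hπ]
  · intro y
    rw [LinearMap.toMatrix'_mulVec]
    exact (e.symm y).2
  · intro z hz
    rw [LinearMap.toMatrix'_mulVec, LinearMap.toMatrix'_mulVec]
    have := congrArg Subtype.val (hπ ⟨z, hz⟩)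
    simpa [p, m] using this

/-- The number of lattice points of a rational hyperplane through the origin in `[-r, r]ⁿ`. -/
theorem tendsto_card_boxPts_zero {n : ℕ} {a : Fin n → ℤ} (ha : Finset.univ.gcd a = 1) :
    ∃ C : ℝ, 0 < C ∧
      Tendsto (fun r : ℝ => ((boxPts a 0 r).card : ℝ) / r ^ (n - 1)) atTop (𝓝 C) := by
  obtain ⟨M, P, hPM, haM, hMP⟩ := exists_param_kernel ha
  let M' : (Fin (n - 1) → ℝ) →ₗ[ℝ] (Fin n → ℝ) := (M.map (Int.castRingHom ℝ)).mulVecLin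
  let P' : (Fin n → ℝ) →ₗ[ℝ] (Fin (n - 1) → ℝ) := (P.map (Int.castRingHom ℝ)).mulVecLin
  have hPM' : ∀ y, P' (M' y) = y := fun y => by
    simp only [P', M', Matrix.mulVecLin_apply, Matrix.mulVec_mulVec]
    rw [← Matrix.map_mul, hPM, Matrix.map_one _ (by simp) (by simp), Matrix.one_mulVec]
  have hM'z : ∀ (y : Fin (n - 1) → ℤ) i, M' (fun j => (y j : ℝ)) i = (M.mulVec y i : ℝ) := by
    intro y i
    simp [M', Matrix.mulVec, dotProduct]
  have hM'c : Continuous M' := M'.continuous_of_finiteDimensional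
  have hP'c : Continuous P' := P'.continuous_of_finiteDimensional
  -- The norm is the sup norm, so `s` is the section of the cube `[-1, 1]ⁿ` by the real hyperplane,
  -- read in the coordinates `M'`.
  let s : Set (Fin (n - 1) → ℝ) := M' ⁻¹' Metric.closedBall 0 1
  have hs_closed : IsClosed s := Metric.isClosed_closedBall.preimage hM'c
  have hs_conv : Convex ℝ s := (convex_closedBall _ _).linear_preimage M'
  have hs_bdd : Bornology.IsBounded s := by
    refine (((isCompact_closedBall (0 : Fin n → ℝ) 1).image hP'c).isBounded).subset ?_
    intro y hy
    exact ⟨M' y, hy, hPM' y⟩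
  have hs_nhds : s ∈ 𝓝 (0 : Fin (n - 1) → ℝ) := by
    apply hM'c.continuousAt.preimage_mem_nhds
    rw [map_zero]
    exact Metric.closedBall_mem_nhds _ one_pos
  have hs_mono : ∀ ⦃x y : ℝ⦄, 0 < x → x ≤ y → x • s ⊆ y • s := by
    intro x y hx hxy
    rw [Set.subset_smul_set_iff₀ (hx.trans_le hxy).ne', smul_smul]
    rintro _ ⟨u, hu, rfl⟩
    simp only [s, Set.mem_preimage, mem_closedBall_zero_iff, map_smul, norm_smul] at hu ⊢
    have h1 : ‖y⁻¹ * x‖ ≤ 1 := by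
      have : 0 < y := hx.trans_le hxy
      rw [Real.norm_of_nonneg (by positivity), inv_mul_le_iff₀ this]
      linarith
    exact mul_le_one₀ h1 (norm_nonneg _) hu
  refine ⟨MeasureTheory.volume.real s, ?_, ?_⟩
  · rw [MeasureTheory.measureReal_def]
    exact ENNReal.toReal_pos (MeasureTheory.Measure.measure_pos_of_mem_nhds _ hs_nhds).ne'
      hs_bdd.measure_lt_top.ne
  · have h := tendsto_card_div_pow_atTop_volume' s hs_bdd hs_closed.measurableSet
      (hs_conv.addHaar_frontier _) hs_mono
    rw [Fintype.card_fin] at h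
    refine h.congr' ?_
    filter_upwards [eventually_gt_atTop (0 : ℝ)] with r hr
    congr 2
    rw [← Nat.card_eq_finsetCard]
    symm
    -- Lattice coordinates rescaled by `1 / r`: the points to count become those of `r⁻¹ ℤⁿ⁻¹` in
    -- the fixed set `s`.
    let F : (Fin n → ℤ) → (Fin (n - 1) → ℝ) := fun z => r⁻¹ • fun j => (P.mulVec z j : ℝ)
    have hMF : ∀ z ∈ boxPts a 0 r, M' (F z) = r⁻¹ • fun i => (z i : ℝ) := by
      intro z hz
      rw [map_smul]
      congr 1
      funext i
      rw [hM'z, hMP z (mem_boxPts.1 hz).2]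
    have hbij : Set.BijOn F (boxPts a 0 r) (s ∩ r⁻¹ • (Submodule.span ℤ
        (Set.range (Pi.basisFun ℝ (Fin (n - 1)))) : Set (Fin (n - 1) → ℝ))) := by
      refine ⟨?_, ?_, ?_⟩
      · intro z hz
        refine ⟨?_, Set.smul_mem_smul_set ?_⟩
        · simp only [s, Set.mem_preimage, mem_closedBall_zero_iff]
          rw [hMF z hz, norm_smul, norm_inv, Real.norm_of_nonneg hr.le, inv_mul_le_iff₀ hr, mul_one,
            pi_norm_le_iff_of_nonneg hr.le]
          exact (mem_boxPts.1 hz).1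
        · rw [SetLike.mem_coe, Module.Basis.mem_span_iff_repr_mem]
          intro j
          exact ⟨P.mulVec z j, by simp⟩
      · intro z hz w hw h
        have h2 := congrArg M' h
        rw [hMF z hz, hMF w hw] at h2
        exact intCast_injective n (smul_right_injective _ (inv_ne_zero hr.ne') h2)
      · rintro _ ⟨hys, u, hu, rfl⟩
        rw [SetLike.mem_coe, Module.Basis.mem_span_iff_repr_mem] at hu
        choose y hy using hu
        have hy' : u = fun j => (y j : ℝ) := by
          funext j
          have := hy j
          simp at this
          exact this.symm
        subst hy'
        refine ⟨M.mulVec y, ?_, ?_⟩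
        · rw [Finset.mem_coe, mem_boxPts]
          refine ⟨fun i => ?_, haM y⟩
          simp only [s, Set.mem_preimage, mem_closedBall_zero_iff, map_smul] at hys
          rw [norm_smul, norm_inv, Real.norm_of_nonneg hr.le, inv_mul_le_iff₀ hr, mul_one,
            pi_norm_le_iff_of_nonneg hr.le] at hys
          have := hys i
          rwa [hM'z] at this
        · simp only [F, Matrix.mulVec_mulVec, hPM, Matrix.one_mulVec]
    exact Nat.card_congr (hbij.equiv F)

/-- Translation by `(b' - b) • v`, where `a · v = 1`, changes the level from `b` to `b'` and
enlarges the box by a bounded amount. -/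
theorem exists_card_boxPts_le {n : ℕ} {a : Fin n → ℤ} (ha : Finset.univ.gcd a = 1) (b b' : ℤ) :
    ∃ c : ℝ, ∀ r, (boxPts a b r).card ≤ (boxPts a b' (r + c)).card := by
  obtain ⟨v, hv⟩ := exists_sum_mul_eq_one ha
  refine ⟨∑ i, |(((b' - b) * v i : ℤ) : ℝ)|, fun r => ?_⟩
  refine Finset.card_le_card_of_injOn (fun z i => z i + (b' - b) * v i) ?_ ?_
  · intro z hz
    rw [Finset.mem_coe, mem_boxPts] at hz ⊢
    refine ⟨fun i => ?_, ?_⟩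
    · rw [Int.cast_add]
      refine (abs_add_le _ _).trans (add_le_add (hz.1 i) ?_)
      exact Finset.single_le_sum (f := fun i => |(((b' - b) * v i : ℤ) : ℝ)|)
        (fun i _ => abs_nonneg _) (Finset.mem_univ i)
    · simp only [mul_add, Finset.sum_add_distrib, hz.2, mul_left_comm (a _), ← Finset.mul_sum, hv]
      ring
  · intro z _ w _ h
    funext i
    exact add_right_cancel (congrFun h i)

theorem tendsto_div_pow_comp_add {f : ℝ → ℝ} {k : ℕ} {C : ℝ}
    (h : Tendsto (fun r => f r / r ^ k) atTop (𝓝 C)) (c : ℝ) :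
    Tendsto (fun r => f (r + c) / r ^ k) atTop (𝓝 C) := by
  have h1 : Tendsto (fun r : ℝ => r + c) atTop atTop := tendsto_atTop_add_const_right _ _ tendsto_id
  have h2 : Tendsto (fun r : ℝ => ((r + c) / r) ^ k) atTop (𝓝 1) := by
    have h3 : Tendsto (fun r : ℝ => 1 + c * r⁻¹) atTop (𝓝 (1 + c * 0)) :=
      tendsto_const_nhds.add (tendsto_const_nhds.mul tendsto_inv_atTop_zero)
    have h4 := h3.pow k
    rw [mul_zero, add_zero, one_pow] at h4
    refine h4.congr' ?_
    filter_upwards [eventually_gt_atTop 0] with r hr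
    congr 1
    field_simp
  have h5 := (h.comp h1).mul h2
  rw [mul_one] at h5
  refine h5.congr' ?_
  filter_upwards [eventually_gt_atTop 0, h1.eventually_gt_atTop 0] with r hr hr'
  simp only [Function.comp, div_pow]
  field_simp

/-- One constant for all levels is what lets the sieve compare level `q * b` with level `b`. The
count is squeezed between those of level `0` at radii `r - d` and `r + c`. -/
theorem tendsto_card_boxPts {n : ℕ} {a : Fin n → ℤ} (ha : Finset.univ.gcd a = 1) :
    ∃ C : ℝ, 0 < C ∧ ∀ b,
      Tendsto (fun r : ℝ => ((boxPts a b r).card : ℝ) / r ^ (n - 1)) atTop (𝓝 C) := by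
  obtain ⟨C, hC, h⟩ := tendsto_card_boxPts_zero ha
  refine ⟨C, hC, fun b => ?_⟩
  obtain ⟨c, hc⟩ := exists_card_boxPts_le ha b 0
  obtain ⟨d, hd⟩ := exists_card_boxPts_le ha 0 b
  refine tendsto_of_tendsto_of_tendsto_of_le_of_le'
    (tendsto_div_pow_comp_add h (-d)) (tendsto_div_pow_comp_add h c) ?_ ?_
  · filter_upwards [eventually_gt_atTop 0] with r hr
    have := hd (r + -d)
    rw [neg_add_cancel_right] at this
    gcongr
  · filter_upwards [eventually_gt_atTop 0] with r hr
    have := hc r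
    gcongr

/-! ### Sieving by finitely many primes dividing the level -/

/-- The points of `boxPts a b r` divisible by none of the elements of `S`. -/
noncomputable def sievedPts {n : ℕ} (a : Fin n → ℤ) (b : ℤ) (S : Finset ℕ) (r : ℝ) :
    Finset (Fin n → ℤ) :=
  (boxPts a b r).filter fun z => ∀ p ∈ S, ¬ ∀ i, (p : ℤ) ∣ z i

theorem mem_sievedPts {n : ℕ} {a : Fin n → ℤ} {b : ℤ} {S : Finset ℕ} {r : ℝ} {z : Fin n → ℤ} :
    z ∈ sievedPts a b S r ↔ z ∈ boxPts a b r ∧ ∀ p ∈ S, ¬ ∀ i, (p : ℤ) ∣ z i :=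
  Finset.mem_filter

/-- The bijection is `w ↦ q w`; the conditions at `p ∈ S` survive it since `p` and `q` are coprime.
-/
theorem card_filter_dvd_sievedPts {n : ℕ} (a : Fin n → ℤ) (b : ℤ) {S : Finset ℕ} {q : ℕ} (r : ℝ)
    (hS : ∀ p ∈ S, p.Prime) (hq : q.Prime) (hqS : q ∉ S) :
    ((sievedPts a (q * b) S r).filter fun z => ∀ i, (q : ℤ) ∣ z i).card =
      (sievedPts a b S (r / q)).card := by
  have hq0 : (q : ℤ) ≠ 0 := by exact_mod_cast hq.ne_zero
  have hq0' : (0 : ℝ) < q := by exact_mod_cast hq.pos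
  symm
  refine Finset.card_bij (fun z _ i => q * z i) ?_ ?_ ?_
  · intro z hz
    rw [mem_sievedPts, mem_boxPts] at hz
    rw [Finset.mem_filter, mem_sievedPts, mem_boxPts]
    refine ⟨⟨⟨fun i => ?_, ?_⟩, fun p hp h => hz.2 p hp fun i => ?_⟩, fun i => dvd_mul_right _ _⟩
    · have := hz.1.1 i
      rw [le_div_iff₀ hq0'] at this
      rw [Int.cast_mul, abs_mul, Int.cast_natCast, Nat.abs_cast]
      linarith
    · rw [← hz.1.2, Finset.mul_sum]
      exact Finset.sum_congr rfl fun i _ => mul_left_comm _ _ _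
    · have hpq : IsCoprime (p : ℤ) q := by
        rw [Nat.isCoprime_iff_coprime, Nat.coprime_primes (hS p hp) hq]
        rintro rfl
        exact hqS hp
      exact hpq.dvd_of_dvd_mul_left (h i)
  · intro z _ w _ h
    funext i
    exact mul_left_cancel₀ hq0 (congrFun h i)
  · intro z hz
    rw [Finset.mem_filter, mem_sievedPts, mem_boxPts] at hz
    choose w hw using hz.2
    obtain rfl : z = fun i => q * w i := funext hw
    refine ⟨w, ?_, rfl⟩
    rw [mem_sievedPts, mem_boxPts]
    refine ⟨⟨fun i => ?_, ?_⟩, fun p hp h => hz.1.2 p hp fun i => (h i).mul_left _⟩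
    · have := hz.1.1.1 i
      rw [Int.cast_mul, abs_mul, Int.cast_natCast, Nat.abs_cast] at this
      rw [le_div_iff₀ hq0']
      linarith
    · refine mul_left_cancel₀ hq0 ?_
      rw [← hz.1.1.2, Finset.mul_sum]
      exact Finset.sum_congr rfl fun i _ => mul_left_comm _ _ _

theorem card_sievedPts_insert {n : ℕ} (a : Fin n → ℤ) (b : ℤ) {S : Finset ℕ} {q : ℕ} (r : ℝ)
    (hS : ∀ p ∈ S, p.Prime) (hq : q.Prime) (hqS : q ∉ S) :
    (sievedPts a (q * b) (insert q S) r).card + (sievedPts a b S (r / q)).card =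
      (sievedPts a (q * b) S r).card := by
  rw [← card_filter_dvd_sievedPts a b r hS hq hqS,
    ← Finset.card_filter_add_card_filter_not (s := sievedPts a (q * b) S r)
      (fun z => ∀ i, (q : ℤ) ∣ z i), add_comm]
  congr 2
  ext z
  simp only [mem_sievedPts, Finset.mem_filter, Finset.forall_mem_insert]
  tauto

theorem tendsto_card_sievedPts {n : ℕ} {a : Fin n → ℤ} {C : ℝ}
    (h : ∀ b, Tendsto (fun r : ℝ => ((boxPts a b r).card : ℝ) / r ^ (n - 1)) atTop (𝓝 C))
    (S : Finset ℕ) (hS : ∀ p ∈ S, p.Prime) (b : ℤ) (hb : ∀ p ∈ S, (p : ℤ) ∣ b) :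
    Tendsto (fun r : ℝ => ((sievedPts a b S r).card : ℝ) / r ^ (n - 1)) atTop
      (𝓝 (C * ∏ p ∈ S, (1 - 1 / (p : ℝ) ^ (n - 1)))) := by
  -- The level must vary: removing `q` from level `q * c` calls on the sieve by `S` at both levels
  -- `q * c` and `c`.
  induction S using Finset.induction_on generalizing b with
  | empty => simpa [sievedPts] using h b
  | insert q S hqS ih =>
    rw [Finset.forall_mem_insert] at hS hb
    obtain ⟨⟨c, rfl⟩, hb⟩ := hb
    have hc : ∀ p ∈ S, (p : ℤ) ∣ c := fun p hp => by
      have hpq : IsCoprime (p : ℤ) q := by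
        rw [Nat.isCoprime_iff_coprime, Nat.coprime_primes (hS.2 p hp) hS.1]
        rintro rfl
        exact hqS hp
      exact hpq.dvd_of_dvd_mul_left (hb p hp)
    have hq0 : (0 : ℝ) < q := by exact_mod_cast hS.1.pos
    have h1 := ih hS.2 (q * c) hb
    have h2 := (ih hS.2 c hc).comp (tendsto_id.atTop_div_const hq0)
    have h3 := h1.sub (h2.mul_const (1 / (q : ℝ) ^ (n - 1)))
    have h4 : C * ∏ p ∈ S, (1 - 1 / (p : ℝ) ^ (n - 1)) -
        C * (∏ p ∈ S, (1 - 1 / (p : ℝ) ^ (n - 1))) * (1 / (q : ℝ) ^ (n - 1)) =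
        C * ∏ p ∈ insert q S, (1 - 1 / (p : ℝ) ^ (n - 1)) := by
      rw [Finset.prod_insert hqS]
      ring
    rw [h4] at h3
    refine h3.congr' ?_
    filter_upwards [eventually_gt_atTop 0] with r hr
    rw [← card_sievedPts_insert a c r hS.2 hS.1 hqS]
    simp only [Function.comp, id, Nat.cast_add, div_pow]
    field_simp
    ring

theorem tendsto_card_sievedPts_div_card {n : ℕ} {a : Fin n → ℤ} {C : ℝ} (hC : 0 < C)
    (h : ∀ b, Tendsto (fun r : ℝ => ((boxPts a b r).card : ℝ) / r ^ (n - 1)) atTop (𝓝 C))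
    (S : Finset ℕ) (hS : ∀ p ∈ S, p.Prime) (b : ℤ) (hb : ∀ p ∈ S, (p : ℤ) ∣ b) :
    Tendsto (fun r : ℝ => ((sievedPts a b S r).card : ℝ) / (boxPts a b r).card) atTop
      (𝓝 (∏ p ∈ S, (1 - 1 / (p : ℝ) ^ (n - 1)))) := by
  have h1 := (tendsto_card_sievedPts h S hS b hb).div (h b) hC.ne'
  rw [mul_div_cancel_left₀ _ hC.ne'] at h1
  refine h1.congr' ?_
  filter_upwards [eventually_gt_atTop 0] with r hr
  exact div_div_div_cancel_right₀ (pow_ne_zero _ hr.ne') _ _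

theorem eventually_card_boxPts_pos {n : ℕ} {a : Fin n → ℤ} {b : ℤ} {C : ℝ} (hC : 0 < C)
    (h : Tendsto (fun r : ℝ => ((boxPts a b r).card : ℝ) / r ^ (n - 1)) atTop (𝓝 C)) :
    ∀ᶠ r in atTop, 0 < (boxPts a b r).card := by
  filter_upwards [h.eventually_const_lt hC] with r hr
  rw [Nat.pos_iff_ne_zero]
  intro h0
  simp [h0] at hr

theorem gcd_eq_one_iff_forall_prime {n : ℕ} (z : Fin n → ℤ) :
    Finset.univ.gcd z = 1 ↔ ∀ p : ℕ, p.Prime → ¬ ∀ i, (p : ℤ) ∣ z i := by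
  have key : ∀ p : ℕ, (∀ i, (p : ℤ) ∣ z i) ↔ p ∣ (Finset.univ.gcd z).natAbs := fun p => by
    rw [← Int.natCast_dvd, Finset.dvd_gcd_iff]
    simp
  simp only [key]
  have hn : 0 ≤ Finset.univ.gcd z := by
    rw [← Finset.normalize_gcd]; exact Int.nonneg_of_normalize_eq_self (by simp)
  have := Nat.eq_one_iff_not_exists_prime_dvd (n := (Finset.univ.gcd z).natAbs)
  rw [← this]
  omega

theorem dvd_of_forall_dvd_mem_boxPts {n : ℕ} {a : Fin n → ℤ} {b : ℤ} {r : ℝ} {z : Fin n → ℤ}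
    (hz : z ∈ boxPts a b r) {d : ℤ} (h : ∀ i, d ∣ z i) : d ∣ b := by
  rw [← (mem_boxPts.1 hz).2]
  exact Finset.dvd_sum fun i _ => (h i).mul_left _

/-- Any prime dividing all coordinates divides `b`, so the finitely many prime factors of `b` are
the only ones to test. -/
theorem filter_gcd_boxPts_eq_sievedPts {n : ℕ} (a : Fin n → ℤ) {b : ℤ} (hb : b ≠ 0) (r : ℝ) :
    ((boxPts a b r).filter fun z => Finset.univ.gcd z = 1) =
      sievedPts a b b.natAbs.primeFactors r := by
  ext z
  rw [Finset.mem_filter, mem_sievedPts, gcd_eq_one_iff_forall_prime]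
  refine and_congr_right fun hz => ⟨fun h p hp => h p (Nat.prime_of_mem_primeFactors hp), ?_⟩
  intro h p hp hd
  refine h p (Nat.mem_primeFactors.2 ⟨hp, ?_, by simpa using hb⟩) hd
  exact Int.natCast_dvd.1 (dvd_of_forall_dvd_mem_boxPts hz hd)

theorem filter_gcd_boxPts_subset_sievedPts {n : ℕ} (a : Fin n → ℤ) (b : ℤ) (r : ℝ)
    {S : Finset ℕ} (hS : ∀ p ∈ S, p.Prime) :
    ((boxPts a b r).filter fun z => Finset.univ.gcd z = 1) ⊆ sievedPts a b S r := by
  intro z hz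
  rw [Finset.mem_filter, gcd_eq_one_iff_forall_prime] at hz
  exact mem_sievedPts.2 ⟨hz.1, fun p hp => hz.2 p (hS p hp)⟩

/-! ### The Jordan totient by the same sieve -/

/-- The tuples in `{0, …, m - 1}ᵏ` divisible by none of the elements of `S`. -/
def sievedTuples (k m : ℕ) (S : Finset ℕ) : Finset (Fin k → ℕ) :=
  (Fintype.piFinset fun _ : Fin k => Finset.range m).filter fun v => ∀ p ∈ S, ¬ ∀ i, p ∣ v i

theorem mem_sievedTuples {k m : ℕ} {S : Finset ℕ} {v : Fin k → ℕ} :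
    v ∈ sievedTuples k m S ↔ (∀ i, v i < m) ∧ ∀ p ∈ S, ¬ ∀ i, p ∣ v i := by
  simp [sievedTuples]

theorem card_sievedTuples_insert (k m : ℕ) {S : Finset ℕ} {q : ℕ}
    (hS : ∀ p ∈ S, p.Prime) (hq : q.Prime) (hqS : q ∉ S) :
    (sievedTuples k (q * m) (insert q S)).card + (sievedTuples k m S).card =
      (sievedTuples k (q * m) S).card := by
  have h : (sievedTuples k m S).card =
      ((sievedTuples k (q * m) S).filter fun v => ∀ i, q ∣ v i).card := by
    refine Finset.card_bij (fun v _ i => q * v i) ?_ ?_ ?_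
    · intro v hv
      rw [mem_sievedTuples] at hv
      rw [Finset.mem_filter, mem_sievedTuples]
      refine ⟨⟨fun i => Nat.mul_lt_mul_of_pos_left (hv.1 i) hq.pos,
        fun p hp h => hv.2 p hp fun i => ?_⟩, fun i => dvd_mul_right _ _⟩
      have hpq : p.Coprime q := by
        rw [Nat.coprime_primes (hS p hp) hq]
        rintro rfl
        exact hqS hp
      exact hpq.dvd_of_dvd_mul_left (h i)
    · intro v _ w _ h
      funext i
      exact Nat.eq_of_mul_eq_mul_left hq.pos (congrFun h i)
    · intro v hv
      rw [Finset.mem_filter, mem_sievedTuples] at hv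
      choose w hw using hv.2
      obtain rfl : v = fun i => q * w i := funext hw
      exact ⟨w, mem_sievedTuples.2 ⟨fun i => Nat.lt_of_mul_lt_mul_left (hv.1.1 i),
        fun p hp h => hv.1.2 p hp fun i => (h i).mul_left _⟩, rfl⟩
  rw [h, ← Finset.card_filter_add_card_filter_not (s := sievedTuples k (q * m) S)
      (fun v => ∀ i, q ∣ v i), add_comm]
  congr 2
  ext z
  simp only [mem_sievedTuples, Finset.mem_filter, Finset.forall_mem_insert]
  tauto

theorem card_sievedTuples (k : ℕ) (S : Finset ℕ) (hS : ∀ p ∈ S, p.Prime) (m : ℕ)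
    (hm : ∀ p ∈ S, p ∣ m) :
    ((sievedTuples k m S).card : ℝ) = (m : ℝ) ^ k * ∏ p ∈ S, (1 - 1 / (p : ℝ) ^ k) := by
  induction S using Finset.induction_on generalizing m with
  | empty => simp [sievedTuples]
  | insert q S hqS ih =>
    rw [Finset.forall_mem_insert] at hS hm
    obtain ⟨⟨c, rfl⟩, hm⟩ := hm
    have hc : ∀ p ∈ S, p ∣ c := fun p hp => by
      have hpq : p.Coprime q := by
        rw [Nat.coprime_primes (hS.2 p hp) hS.1]
        rintro rfl
        exact hqS hp
      exact hpq.dvd_of_dvd_mul_left (hm p hp)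
    have hq0 : (q : ℝ) ≠ 0 := by exact_mod_cast hS.1.ne_zero
    have h1 := ih hS.2 (q * c) hm
    rw [← card_sievedTuples_insert k c hS.2 hS.1 hqS, Nat.cast_add, ih hS.2 c hc,
      ← eq_sub_iff_add_eq] at h1
    rw [h1, Finset.prod_insert hqS]
    push_cast
    field_simp
    ring

theorem jordanTotient_eq (k : ℕ) {m : ℕ} (hm : m ≠ 0) :
    (jordanTotient k m : ℝ) = (m : ℝ) ^ k * ∏ p ∈ m.primeFactors, (1 - 1 / (p : ℝ) ^ k) := by
  rw [← card_sievedTuples k m.primeFactors (fun p => Nat.prime_of_mem_primeFactors) m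
    (fun p => Nat.dvd_of_mem_primeFactors)]
  congr 1
  unfold jordanTotient sievedTuples
  congr 1
  refine Finset.filter_congr fun v _ => ?_
  rw [Nat.Coprime, Nat.eq_one_iff_not_exists_prime_dvd]
  simp only [Nat.dvd_gcd_iff, Finset.dvd_gcd_iff, Finset.mem_univ, true_imp_iff, Nat.mem_primeFactors]
  constructor
  · rintro h p ⟨hp, hpm, -⟩ hd
    exact h p hp ⟨hd, hpm⟩
  · rintro h p hp ⟨hd, hpm⟩
    exact h p ⟨hp, hpm, hm⟩ hd

/-! ### Infinite products over primes -/

theorem antitone_prod_of_mem_Icc {ι : Type*} {f : ι → ℝ} (hf : ∀ i, f i ∈ Set.Icc (0 : ℝ) 1) :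
    Antitone fun s : Finset ι => ∏ i ∈ s, f i := by
  classical
  intro s t hst
  beta_reduce
  rw [← Finset.prod_sdiff hst]
  exact mul_le_of_le_one_left (Finset.prod_nonneg fun i _ => (hf i).1)
    (Finset.prod_le_one (fun i _ => (hf i).1) fun i _ => (hf i).2)

theorem exists_hasProd_of_mem_Icc {ι : Type*} {f : ι → ℝ} (hf : ∀ i, f i ∈ Set.Icc (0 : ℝ) 1) :
    ∃ ρ, HasProd f ρ := by
  refine ⟨_, tendsto_atTop_ciInf (antitone_prod_of_mem_Icc hf) ⟨0, ?_⟩⟩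
  rintro _ ⟨s, rfl⟩
  exact Finset.prod_nonneg fun i _ => (hf i).1

theorem HasProd.le_prod_of_mem_Icc {ι : Type*} {f : ι → ℝ} {ρ : ℝ}
    (hf : ∀ i, f i ∈ Set.Icc (0 : ℝ) 1) (h : HasProd f ρ) (s : Finset ι) : ρ ≤ ∏ i ∈ s, f i :=
  (antitone_prod_of_mem_Icc hf).le_of_tendsto h s

/-- From `1 - x ≤ exp (-x)`, partial products are at most `exp (-∑ g)`, and the partial sums tend to
infinity. -/
theorem hasProd_one_sub_zero_of_not_summable {ι : Type*} {g : ι → ℝ}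
    (hg : ∀ i, g i ∈ Set.Icc (0 : ℝ) 1) (h : ¬ Summable g) : HasProd (fun i => 1 - g i) 0 := by
  have h1 : Tendsto (fun s : Finset ι => ∑ i ∈ s, g i) atTop atTop := by
    refine (tendsto_atTop_of_monotone ?_).resolve_right ?_
    · exact Finset.sum_mono_set_of_nonneg fun i => (hg i).1
    · rintro ⟨l, hl⟩
      exact h ⟨l, hl⟩
  refine squeeze_zero (fun s => Finset.prod_nonneg fun i _ => sub_nonneg.2 (hg i).2) ?_
    (Real.tendsto_exp_neg_atTop_nhds_zero.comp h1)
  intro s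
  simp only [Function.comp, ← Finset.sum_neg_distrib, Real.exp_sum]
  exact Finset.prod_le_prod (fun i _ => sub_nonneg.2 (hg i).2) fun i _ => by
    linarith [Real.add_one_le_exp (-g i)]

theorem one_div_prime_pow_mem_Icc {p : ℕ} (hp : p.Prime) (k : ℕ) :
    1 / (p : ℝ) ^ k ∈ Set.Icc (0 : ℝ) 1 := by
  have h : (1 : ℝ) ≤ p := by exact_mod_cast hp.one_le
  refine ⟨by positivity, ?_⟩
  rw [div_le_one (by positivity)]
  exact one_le_pow₀ h

theorem hasProd_one_sub_one_div_primes : HasProd (fun p : Nat.Primes => 1 - 1 / (p : ℝ)) 0 := by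
  refine hasProd_one_sub_zero_of_not_summable (fun p => ?_) Nat.Primes.not_summable_one_div
  simpa using one_div_prime_pow_mem_Icc p.2 1

theorem one_div_riemannZeta_of_hasProd {k : ℕ} (hk : 2 ≤ k) {ρ : ℝ}
    (h : HasProd (fun p : Nat.Primes => 1 - 1 / (p : ℝ) ^ k) ρ) :
    (ρ : ℂ) = 1 / riemannZeta k := by
  have hk1 : 1 < (k : ℂ).re := by
    rw [Complex.natCast_re]
    exact_mod_cast hk
  have h1 := (riemannZeta_eulerProduct_hasProd hk1).inv₀ (riemannZeta_ne_zero_of_one_lt_re hk1)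
  have h2 : HasProd (fun p : Nat.Primes => ((1 - 1 / (p : ℝ) ^ k : ℝ) : ℂ)) (ρ : ℂ) :=
    h.map Complex.ofRealHom Complex.continuous_ofReal
  have h3 : (fun p : Nat.Primes => ((1 - 1 / (p : ℝ) ^ k : ℝ) : ℂ)) =
      fun p : Nat.Primes => ((1 - (p : ℂ) ^ (-(k : ℂ)))⁻¹)⁻¹ := funext fun p => by
    rw [inv_inv, Complex.cpow_neg, Complex.cpow_natCast]
    push_cast
    rw [one_div]
  rw [h3] at h2
  rw [one_div]
  exact h2.unique h1

/-! ### Bounds for visible points, with a tail estimate at level zero -/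

/-- A bound uniform in `s`, needed since `s = r / p` with `p` up to `r`. The origin is removed so
that nothing is left for `s < 1`; monotonicity covers `1 ≤ s ≤ R`, the asymptotics `s ≥ R`. -/
theorem exists_card_erase_boxPts_le {n : ℕ} {a : Fin n → ℤ} {C : ℝ} (hC : 0 < C)
    (h : Tendsto (fun r : ℝ => ((boxPts a 0 r).card : ℝ) / r ^ (n - 1)) atTop (𝓝 C)) :
    ∃ D : ℝ, 0 ≤ D ∧ ∀ s : ℝ, 0 < s → (((boxPts a 0 s).erase 0).card : ℝ) ≤ D * s ^ (n - 1) := by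
  obtain ⟨R, hR⟩ := eventually_atTop.1 (h.eventually_le_const (lt_add_one C))
  refine ⟨max (C + 1) (boxPts a 0 R).card, le_max_of_le_left (by linarith), fun s hs => ?_⟩
  rcases lt_or_ge s 1 with h1 | h1
  · have h0 : (boxPts a 0 s).erase 0 = ∅ := by
      refine Finset.eq_empty_of_forall_notMem fun z hz => ?_
      rw [Finset.mem_erase, mem_boxPts] at hz
      refine hz.1 (funext fun i => ?_)
      have h2 := (hz.2.1 i).trans_lt h1
      have h3 : |z i| < 1 := by exact_mod_cast h2
      exact Int.abs_lt_one_iff.1 h3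
    rw [h0, Finset.card_empty, Nat.cast_zero]
    exact mul_nonneg (le_max_of_le_left (by linarith)) (by positivity)
  · have h2 : (((boxPts a 0 s).erase 0).card : ℝ) ≤ (boxPts a 0 s).card := by
      exact_mod_cast Finset.card_erase_le
    refine h2.trans ?_
    rcases le_total R s with h3 | h3
    · have h4 := hR s h3
      rw [div_le_iff₀ (by positivity)] at h4
      exact h4.trans (by gcongr; exact le_max_left _ _)
    · have h4 : ((boxPts a 0 s).card : ℝ) ≤ (boxPts a 0 R).card := by
        exact_mod_cast Finset.card_le_card (boxPts_mono a 0 h3)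
      refine h4.trans ((le_max_right (C + 1) _).trans ?_)
      exact le_mul_of_one_le_right (le_max_of_le_left (by linarith)) (one_le_pow₀ h1)

theorem card_filter_dvd_erase_boxPts_le {n : ℕ} (a : Fin n → ℤ) (r : ℝ) {p : ℕ} (hp : 0 < p) :
    (((boxPts a 0 r).erase 0).filter fun z => ∀ i, (p : ℤ) ∣ z i).card ≤
      ((boxPts a 0 (r / p)).erase 0).card := by
  have hp0 : (p : ℤ) ≠ 0 := by exact_mod_cast hp.ne'
  have hp0' : (0 : ℝ) < p := by exact_mod_cast hp
  refine Finset.card_le_card_of_surjOn (fun z i => p * z i) ?_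
  intro z hz
  rw [Finset.mem_coe, Finset.mem_filter, Finset.mem_erase, mem_boxPts] at hz
  choose w hw using hz.2
  obtain rfl : z = fun i => p * w i := funext hw
  refine ⟨w, ?_, rfl⟩
  rw [Finset.mem_coe, Finset.mem_erase, mem_boxPts]
  refine ⟨?_, fun i => ?_, ?_⟩
  · rintro rfl
    exact hz.1.1 (funext fun i => by simp)
  · have := hz.1.2.1 i
    rw [Int.cast_mul, abs_mul, Int.cast_natCast, Nat.abs_cast] at this
    rw [le_div_iff₀ hp0']
    linarith
  · refine mul_left_cancel₀ hp0 ?_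
    rw [mul_zero, ← hz.1.2.2, Finset.mul_sum]
    exact Finset.sum_congr rfl fun i _ => mul_left_comm _ _ _

/-- A nonzero sieved point that is not visible is divisible by some prime `p ≥ Q`, and `p ≤ r`
because a nonzero coordinate is at least `p` in absolute value. The `1` is for the origin; summing
over all integers `p` rather than primes only weakens the bound. -/
theorem card_sievedPts_le {n : ℕ} (a : Fin n → ℤ) (r : ℝ) (Q : ℕ) (hQ : 0 < Q) :
    (sievedPts a 0 ((Finset.range Q).filter Nat.Prime) r).card ≤
      ((boxPts a 0 r).filter fun z => Finset.univ.gcd z = 1).card + 1 +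
        ∑ p ∈ Finset.Ico Q (⌊r⌋₊ + 1), ((boxPts a 0 (r / p)).erase 0).card := by
  classical
  have hsub : sievedPts a 0 ((Finset.range Q).filter Nat.Prime) r ⊆
      ((boxPts a 0 r).filter fun z => Finset.univ.gcd z = 1) ∪ {0} ∪
        (Finset.Ico Q (⌊r⌋₊ + 1)).biUnion fun p =>
          ((boxPts a 0 r).erase 0).filter fun z => ∀ i, (p : ℤ) ∣ z i := by
    intro z hz
    rw [mem_sievedPts] at hz
    simp only [Finset.mem_union, Finset.mem_filter, Finset.mem_singleton, Finset.mem_biUnion,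
      Finset.mem_Ico, Finset.mem_erase]
    by_cases h0 : z = 0
    · exact Or.inl (Or.inr h0)
    by_cases hg : Finset.univ.gcd z = 1
    · exact Or.inl (Or.inl ⟨hz.1, hg⟩)
    right
    rw [gcd_eq_one_iff_forall_prime] at hg
    push Not at hg
    obtain ⟨p, hp, hd⟩ := hg
    refine ⟨p, ⟨?_, ?_⟩, ⟨h0, hz.1⟩, hd⟩
    · by_contra! hlt
      exact hz.2 p (Finset.mem_filter.2 ⟨Finset.mem_range.2 hlt, hp⟩) hd
    · obtain ⟨i, hi⟩ := Function.ne_iff.1 h0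
      rw [Nat.lt_succ_iff]
      refine Nat.le_floor (le_trans ?_ ((mem_boxPts.1 hz.1).1 i))
      have h1 : (p : ℤ) ≤ |z i| := Int.le_of_dvd (abs_pos.2 hi) ((dvd_abs _ _).2 (hd i))
      exact_mod_cast h1
  refine (Finset.card_le_card hsub).trans ((Finset.card_union_le _ _).trans ?_)
  refine add_le_add ((Finset.card_union_le _ _).trans (by simp)) ?_
  refine Finset.card_biUnion_le.trans (Finset.sum_le_sum fun p hp => ?_)
  exact card_filter_dvd_erase_boxPts_le a r (hQ.trans_le (Finset.mem_Ico.1 hp).1)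

/-- Visible points pass every finite sieve, so each finite partial product bounds the upper limit.
-/
theorem eventually_card_filter_gcd_lt {n : ℕ} {a : Fin n → ℤ} {b : ℤ} {C : ℝ} (hC : 0 < C)
    (h : ∀ b, Tendsto (fun r : ℝ => ((boxPts a b r).card : ℝ) / r ^ (n - 1)) atTop (𝓝 C))
    {ρ : ℝ} (hρ : HasProd (fun p : {p : ℕ // p.Prime ∧ (p : ℤ) ∣ b} =>
      1 - 1 / ((p : ℕ) : ℝ) ^ (n - 1)) ρ) {u : ℝ} (hu : ρ < u) :
    ∀ᶠ r : ℝ in atTop, (((boxPts a b r).filter fun z => Finset.univ.gcd z = 1).card : ℝ) /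
      (boxPts a b r).card < u := by
  obtain ⟨T, hT⟩ := (Tendsto.eventually_lt_const hu hρ).exists
  have hS : ∀ p ∈ T.map (Function.Embedding.subtype _), p.Prime ∧ (p : ℤ) ∣ b := by
    intro p hp
    obtain ⟨q, -, rfl⟩ := Finset.mem_map.1 hp
    exact q.2
  have h1 := tendsto_card_sievedPts_div_card hC h _ (fun p hp => (hS p hp).1) b
    fun p hp => (hS p hp).2
  rw [Finset.prod_map] at h1
  filter_upwards [h1.eventually_lt_const hT] with r hr
  refine lt_of_le_of_lt ?_ hr
  gcongr
  exact filter_gcd_boxPts_subset_sievedPts a b r fun p hp => (hS p hp).1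

theorem eventually_lt_card_filter_gcd {n : ℕ} (hn : 3 ≤ n) {a : Fin n → ℤ} {C : ℝ} (hC : 0 < C)
    (h : ∀ b, Tendsto (fun r : ℝ => ((boxPts a b r).card : ℝ) / r ^ (n - 1)) atTop (𝓝 C))
    {ρ : ℝ} (hρ : HasProd (fun p : Nat.Primes => 1 - 1 / ((p : ℕ) : ℝ) ^ (n - 1)) ρ)
    {u : ℝ} (hu : u < ρ) :
    ∀ᶠ r : ℝ in atTop, u < (((boxPts a 0 r).filter fun z => Finset.univ.gcd z = 1).card : ℝ) /
      (boxPts a 0 r).card := by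
  obtain ⟨D, hD, hDle⟩ := exists_card_erase_boxPts_le hC (h 0)
  have hsum : Summable fun m : ℕ => 1 / (m : ℝ) ^ (n - 1) :=
    Real.summable_one_div_nat_pow.2 (by omega)
  set t : ℕ → ℝ := fun Q => ∑' m : ℕ, 1 / ((m + Q : ℕ) : ℝ) ^ (n - 1) with ht
  have htail : Tendsto (fun Q => D * t Q / C) atTop (𝓝 (D * 0 / C)) :=
    ((tendsto_sum_nat_add fun m : ℕ => 1 / (m : ℝ) ^ (n - 1)).const_mul D).div_const C
  rw [mul_zero, zero_div] at htail
  -- `Q` is so large that the density `D * t Q / C` lost to divisors `≥ Q` is below the margin `ρ -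
  -- u`.
  obtain ⟨Q, hQt, hQ⟩ :=
    ((htail.eventually_lt_const (sub_pos.2 hu)).and (eventually_gt_atTop 0)).exists
  have hS : ∀ p ∈ (Finset.range Q).filter Nat.Prime, p.Prime := fun p hp => (Finset.mem_filter.1 hp).2
  have hge : ρ ≤ ∏ p ∈ (Finset.range Q).filter Nat.Prime, (1 - 1 / (p : ℝ) ^ (n - 1)) := by
    rw [← Finset.prod_subtype_of_mem _ hS]
    refine HasProd.le_prod_of_mem_Icc (fun p => ?_) hρ _
    have := one_div_prime_pow_mem_Icc p.2 (n - 1)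
    exact ⟨by linarith [this.2], by linarith [this.1]⟩
  have h1 := tendsto_card_sievedPts_div_card hC h _ hS 0 (fun p _ => dvd_zero _)
  have hpow : Tendsto (fun r : ℝ => r ^ (n - 1)) atTop atTop := tendsto_pow_atTop (by omega)
  have hinv : Tendsto (fun r : ℝ => r ^ (n - 1) / (boxPts a 0 r).card) atTop (𝓝 C⁻¹) := by
    refine ((h 0).inv₀ hC.ne').congr fun r => ?_
    rw [inv_div]
  have h2 : Tendsto (fun r : ℝ => 1 / ((boxPts a 0 r).card : ℝ)) atTop (𝓝 0) := by
    have := hinv.mul hpow.inv_tendsto_atTop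
    rw [mul_zero] at this
    refine this.congr' ?_
    filter_upwards [eventually_gt_atTop 0] with r hr
    simp only [Pi.inv_apply]
    field_simp
  have h3 := (h1.sub h2).sub (hinv.const_mul (D * t Q))
  have h4 : u < (∏ p ∈ (Finset.range Q).filter Nat.Prime, (1 - 1 / (p : ℝ) ^ (n - 1))) - 0 -
      D * t Q * C⁻¹ := by
    rw [← div_eq_mul_inv]
    linarith
  filter_upwards [h3.eventually_const_lt h4, eventually_gt_atTop 0,
    eventually_card_boxPts_pos hC (h 0)] with r hr hr0 hpos
  refine hr.trans_le ?_
  have hpos' : (0 : ℝ) < (boxPts a 0 r).card := by exact_mod_cast hpos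
  have hle : ((sievedPts a 0 ((Finset.range Q).filter Nat.Prime) r).card : ℝ) ≤
      ((boxPts a 0 r).filter fun z => Finset.univ.gcd z = 1).card + 1 +
        ∑ p ∈ Finset.Ico Q (⌊r⌋₊ + 1), (((boxPts a 0 (r / p)).erase 0).card : ℝ) := by
    exact_mod_cast card_sievedPts_le a r Q hQ
  have hle2 : ∑ p ∈ Finset.Ico Q (⌊r⌋₊ + 1), (((boxPts a 0 (r / p)).erase 0).card : ℝ) ≤
      D * t Q * r ^ (n - 1) := by
    calc _ ≤ ∑ p ∈ Finset.Ico Q (⌊r⌋₊ + 1), D * r ^ (n - 1) * (1 / (p : ℝ) ^ (n - 1)) := by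
          refine Finset.sum_le_sum fun p hp => ?_
          have hp0 : (0 : ℝ) < p := by exact_mod_cast hQ.trans_le (Finset.mem_Ico.1 hp).1
          refine (hDle _ (by positivity)).trans (le_of_eq ?_)
          rw [div_pow]
          ring
      _ = D * r ^ (n - 1) * ∑ m ∈ Finset.range (⌊r⌋₊ + 1 - Q),
            1 / ((m + Q : ℕ) : ℝ) ^ (n - 1) := by
          rw [← Finset.mul_sum, Finset.sum_Ico_eq_sum_range]
          simp only [add_comm Q]
      _ ≤ D * r ^ (n - 1) * t Q := by
          gcongr
          exact ((summable_nat_add_iff Q).2 hsum).sum_le_tsum _ fun m _ => by positivity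
      _ = _ := by ring
  rw [div_sub_div_same, mul_div_assoc', div_sub_div_same]
  gcongr
  linarith

/-! ### Assembling the density -/

theorem hasVisibleDensity_hyperplane {n : ℕ} {a : Fin n → ℤ} {b : ℤ} {C : ℝ} (hC : 0 < C)
    (h : Tendsto (fun r : ℝ => ((boxPts a b r).card : ℝ) / r ^ (n - 1)) atTop (𝓝 C)) {ρ : ℝ}
    (hρ : Tendsto (fun r : ℝ => (((boxPts a b r).filter fun z => Finset.univ.gcd z = 1).card : ℝ) /
      (boxPts a b r).card) atTop (𝓝 ρ)) :
    HasVisibleDensity (hyperplane a b) ρ := by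
  refine ⟨?_, ?_⟩
  · filter_upwards [eventually_card_boxPts_pos hC h] with r hr
    rw [latticePts_hyperplane, Set.image_nonempty, Finset.coe_nonempty]
    exact Finset.card_pos.1 hr
  · simpa only [ncard_latticePts_hyperplane, ncard_visiblePts_hyperplane] using hρ

theorem hasProd_prime_dvd {b : ℤ} (hb : b ≠ 0) (f : ℕ → ℝ) :
    HasProd (fun p : {p : ℕ // p.Prime ∧ (p : ℤ) ∣ b} => f p) (∏ p ∈ b.natAbs.primeFactors, f p) := by
  have h : ∀ p : ℕ, (p.Prime ∧ (p : ℤ) ∣ b) ↔ p ∈ b.natAbs.primeFactors := fun p => by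
    rw [Nat.mem_primeFactors_of_ne_zero (by simpa using hb), Int.natCast_dvd]
  exact (Equiv.hasProd_iff (Equiv.subtypeEquivRight h)
    (f := fun p : {p : ℕ // p ∈ b.natAbs.primeFactors} => f p)).2
    (Finset.hasProd b.natAbs.primeFactors f)

end VisibleLattice

theorem corollary3p4 (n : ℕ) (a : Fin n → ℤ) (b : ℤ) (ha : Finset.univ.gcd a = 1) :
    ∃ ρ : ℝ,
      VisibleLattice.HasVisibleDensity (VisibleLattice.hyperplane a b) ρ ∧
      HasProd (fun p : {p : ℕ // p.Prime ∧ (p : ℤ) ∣ b} =>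
        1 - 1 / ((p : ℕ) : ℝ) ^ (n - 1)) ρ ∧
      (b ≠ 0 →
        ρ = (VisibleLattice.jordanTotient (n - 1) b.natAbs : ℝ) / (b.natAbs : ℝ) ^ (n - 1)) ∧
      (b = 0 → n = 2 → ρ = 0) ∧
      (b = 0 → 3 ≤ n → (ρ : ℂ) = 1 / riemannZeta ((n : ℂ) - 1)) := by
  open VisibleLattice in
  obtain ⟨C, hC, h⟩ := tendsto_card_boxPts ha
  by_cases hb : b = 0
  · subst hb
    obtain ⟨ρ, hρ⟩ := exists_hasProd_of_mem_Icc
      (f := fun p : {p : ℕ // p.Prime ∧ (p : ℤ) ∣ 0} => 1 - 1 / ((p : ℕ) : ℝ) ^ (n - 1))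
      fun p => by
        have := one_div_prime_pow_mem_Icc p.2.1 (n - 1)
        exact ⟨by linarith [this.2], by linarith [this.1]⟩
    have hρ' : HasProd (fun p : Nat.Primes => 1 - 1 / ((p : ℕ) : ℝ) ^ (n - 1)) ρ :=
      (Equiv.hasProd_iff (Equiv.subtypeEquivRight fun p : ℕ =>
        (and_iff_left (dvd_zero (p : ℤ)) : (p.Prime ∧ (p : ℤ) ∣ 0) ↔ p.Prime))
        (f := fun p : Nat.Primes => 1 - 1 / ((p : ℕ) : ℝ) ^ (n - 1))).1 hρ
    have hsmall : n < 3 → ρ = 0 := by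
      intro hn
      have hn' : n - 1 = 0 ∨ n - 1 = 1 := by omega
      refine hρ'.unique ?_
      -- With exponent `0` every factor is `1 - 1 = 0`; with exponent `1` the reciprocals of the
      -- primes diverge.
      rcases hn' with hn' | hn'
      · rw [hn']
        exact hasProd_zero_of_exists_eq_zero ⟨⟨2, Nat.prime_two⟩, by simp⟩
      · rw [hn']
        simpa using hasProd_one_sub_one_div_primes
    refine ⟨ρ, hasVisibleDensity_hyperplane hC (h 0) (tendsto_order.2 ⟨fun u hu => ?_, fun u hu =>
      eventually_card_filter_gcd_lt hC h hρ hu⟩), hρ, fun h0 => absurd rfl h0,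
      fun _ hn => hsmall (by omega), fun _ hn => ?_⟩
    -- For `n < 3` the limit is `0`, and the lower bound is just nonnegativity of the ratio.
    · rcases lt_or_ge n 3 with hn | hn
      · rw [hsmall hn] at hu
        exact Eventually.of_forall fun r => hu.trans_le (by positivity)
      · exact eventually_lt_card_filter_gcd hn hC h hρ' hu
    · rw [one_div_riemannZeta_of_hasProd (by omega) hρ', Nat.cast_sub (by omega), Nat.cast_one]
  · refine ⟨∏ p ∈ b.natAbs.primeFactors, (1 - 1 / (p : ℝ) ^ (n - 1)),
      hasVisibleDensity_hyperplane hC (h b) ?_,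
      hasProd_prime_dvd hb fun p => 1 - 1 / (p : ℝ) ^ (n - 1), fun _ => ?_,
      fun h0 => absurd h0 hb, fun h0 => absurd h0 hb⟩
    · simp only [filter_gcd_boxPts_eq_sievedPts a hb]
      exact tendsto_card_sievedPts_div_card hC h _ (fun p => Nat.prime_of_mem_primeFactors) b
        fun p hp => Int.natCast_dvd.2 (Nat.dvd_of_mem_primeFactors hp)
    · have hb' : b.natAbs ≠ 0 := by simpa using hb
      have hb'' : (b.natAbs : ℝ) ≠ 0 := by exact_mod_cast hb'
      rw [jordanTotient_eq _ hb', mul_div_cancel_left₀ _ (pow_ne_zero _ hb'')]
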